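/- Let $\mathfrak h$ be a separable complex Hilbert space and let $D$ be a self-adjoint positive operator in $\mathfrak h$, with domain $\mathrm{Dom}(D)$, that is unbounded (there is no constant $C$ with $\|Dx\|\le C\|x\|$ for all $x\in\mathrm{Dom}(D)$). Then the following two conditions are equivalent: (a) the set $\{x\in\mathrm{Dom}(D) : \|Dx\|^2+\|x\|^2\le 1\}$ is compact in the norm topology of $\mathfrak h$; (b) $D$ has finite-dimensional spectral projections associated with bounded intervals, that is, $D$ has a spectral decomposition $D=\int_{\mathbb R} t\,dE(t)$, where $E$ is a resolution of the identity (projection-valued measure) on the Borel sets of $\mathbb R$, such that the range of $E(I)$ is finite-dimensional for every bounded interval $I\subset\mathbb R$. Moreover, for every resolution of the identity $E$ with $D=\int_{\mathbb R} t\,dE(t)$, condition (a) holds if and only if the range of $E(I)$ is finite-dimensional for every bounded interval $I\subset\mathbb R$. Here $D=\int_{\mathbb R} t\,dE(t)$ means that $\mathrm{Dom}(D)=\{x : \int t^2\,d\langle x,E(t)x\rangle<\infty\}$ and $\langle x,Dx\rangle=\int t\,d\langle x,E(t)x\rangle$ for all $x\in\mathrm{Dom}(D)$. -/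

import Mathlib

open MeasureTheory

/-- A resolution of the identity (projection-valued measure) on the Borel sets of `ℝ`, acting on
the complex Hilbert space `H`. As for Mathlib's vector measures, the value at a non-measurable set
is `0` by convention. -/
structure ResolutionOfIdentity (H : Type*) [NormedAddCommGroup H] [InnerProductSpace ℂ H]
    [CompleteSpace H] where
  /-- The projection attached to a Borel set. -/
  proj : Set ℝ → H →L[ℂ] H
  not_measurable : ∀ s : Set ℝ, ¬ MeasurableSet s → proj s = 0
  proj_empty : proj ∅ = 0
  proj_univ : proj Set.univ = 1
  /-- Every `proj s` is an orthogonal projection. -/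
  isStarProjection : ∀ s : Set ℝ, MeasurableSet s → IsStarProjection (proj s)
  proj_inter : ∀ s t : Set ℝ, MeasurableSet s → MeasurableSet t →
    proj (s ∩ t) = proj s * proj t
  /-- For all `x, y`, the set function `s ↦ ⟪x, proj s y⟫` is countably additive. -/
  hasSum_iUnion : ∀ f : ℕ → Set ℝ, (∀ n, MeasurableSet (f n)) →
    Pairwise (Function.onFun Disjoint f) → ∀ x y : H,
      HasSum (fun n => inner ℂ x (proj (f n) y)) (inner ℂ x (proj (⋃ n, f n) y))

namespace ResolutionOfIdentity

variable {H : Type*} [NormedAddCommGroup H] [InnerProductSpace ℂ H] [CompleteSpace H]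

theorem re_inner_proj_nonneg (E : ResolutionOfIdentity H) (x : H) (s : Set ℝ)
    (hs : MeasurableSet s) : 0 ≤ (inner ℂ x (E.proj s x)).re := by
  have h := E.isStarProjection s hs
  have h1 : E.proj s x = E.proj s (E.proj s x) := by
    conv_lhs => rw [← h.isIdempotentElem.eq]
    rfl
  have h2 : inner ℂ x (E.proj s x) = inner ℂ (E.proj s x) (E.proj s x) := by
    rw [← ContinuousLinearMap.adjoint_inner_right, ← ContinuousLinearMap.star_eq_adjoint,
      h.isSelfAdjoint.star_eq, ← h1]
  rw [h2]
  exact inner_self_nonneg (𝕜 := ℂ)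

/-- The finite positive Borel measure `s ↦ ⟪x, E(s) x⟫`. -/
noncomputable def diagMeasure (E : ResolutionOfIdentity H) (x : H) : Measure ℝ :=
  Measure.ofMeasurable (fun s _ => ENNReal.ofReal (inner ℂ x (E.proj s x)).re)
    (by simp [E.proj_empty])
    (by
      intro f hf hd
      have h := Complex.hasSum_re (E.hasSum_iUnion f hf hd x x)
      rw [← h.tsum_eq]
      exact ENNReal.ofReal_tsum_of_nonneg
        (fun n => E.re_inner_proj_nonneg x (f n) (hf n)) h.summable)

/-- `E` is the spectral decomposition of the operator `D`, i.e. `D = ∫ t dE(t)`: the domain of `D`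
consists of the `x` with `∫ t² d⟪x, E(t) x⟫ < ∞`, and `⟪x, D x⟫ = ∫ t d⟪x, E(t) x⟫` on the domain.
By polarization, the latter amounts to `⟪y, D x⟫ = ∫ t d⟪y, E(t) x⟫` for all `x, y` in the
domain. -/
def IsSpectralDecomposition (E : ResolutionOfIdentity H) (D : H →ₗ.[ℂ] H) : Prop :=
  (∀ x : H, x ∈ D.domain ↔ Integrable (fun t : ℝ => t ^ 2) (E.diagMeasure x)) ∧
  ∀ x : D.domain, inner ℂ (x : H) (D x) = ((∫ t : ℝ, t ∂(E.diagMeasure (x : H)) : ℝ) : ℂ)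

/-- The projections attached to bounded intervals (open, closed, half-open, degenerate) have
finite-dimensional ranges. -/
def FiniteDimOnBoundedIntervals (E : ResolutionOfIdentity H) : Prop :=
  ∀ I : Set ℝ, I.OrdConnected → Bornology.IsBounded I →
    FiniteDimensional ℂ (E.proj I).range

end ResolutionOfIdentity

/-- The operator `D` has a spectral decomposition whose projections associated with bounded
intervals are finite-dimensional. -/
def HasFiniteDimSpectralProjections {H : Type*} [NormedAddCommGroup H] [InnerProductSpace ℂ H]
    [CompleteSpace H] (D : H →ₗ.[ℂ] H) : Prop :=
  ∃ E : ResolutionOfIdentity H, E.IsSpectralDecomposition D ∧ E.FiniteDimOnBoundedIntervals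

/-- The unit ball `{x ∈ Dom D : ‖D x‖² + ‖x‖² ≤ 1}` of the graph norm, as a subset of `H`. -/
def graphUnitBall {H : Type*} [NormedAddCommGroup H] [InnerProductSpace ℂ H]
    (D : H →ₗ.[ℂ] H) : Set H :=
  {x : H | ∃ hx : x ∈ D.domain, ‖D ⟨x, hx⟩‖ ^ 2 + ‖x‖ ^ 2 ≤ 1}

universe u

/-! Fix a spectral decomposition `E` of `D`. Positivity puts the measures `d⟨x, E x⟩` on `[0, ∞)`,
and their mean is `⟨x, D x⟩ ≤ 1` on the graph ball. By Markov's inequality `E [0, r]` moves each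
point of the ball by at most `1/√r`. If the ranges are finite-dimensional, the ball is therefore
totally bounded, and it is closed because `D` is its own adjoint (`norm_sub_proj_sq_le`,
`isClosed_graphUnitBall`). Conversely, on the range of `E I` with `I` bounded, `D` is defined
everywhere, hence bounded by the closed graph theorem. A small ball of the range then lies in the
compact graph ball, and Riesz's theorem applies.

It remains to produce some `E` from compactness. The resolvent `(D + 1)⁻¹` is then a compact
symmetric operator. Its eigenbasis diagonalises `D`, and `E s` projects onto the coordinates with
eigenvalue in `s`. -/

theorem HilbertBasis.ext_inner {ι H : Type*} [NormedAddCommGroup H] [InnerProductSpace ℂ H]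
    (b : HilbertBasis ι ℂ H) {x y : H} (h : ∀ i, inner ℂ (b i) x = inner ℂ (b i) y) : x = y := by
  apply b.repr.injective
  ext i
  rw [b.repr_apply_apply, b.repr_apply_apply, h]

namespace ResolutionOfIdentity

section CoordinateSubspace

variable {ι H : Type*} [NormedAddCommGroup H] [InnerProductSpace ℂ H] (b : HilbertBasis ι ℂ H)
  (lam : ι → ℝ)

/-- The closed subspace of the vectors whose coordinates vanish outside of `lam ⁻¹' s`. -/
noncomputable def coordinateSubspace (s : Set ℝ) : Submodule ℂ H :=
  (Submodule.span ℂ (b '' {i | lam i ∉ s}))ᗮ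

theorem mem_coordinateSubspace_iff {s : Set ℝ} {x : H} :
    x ∈ coordinateSubspace b lam s ↔ ∀ i, lam i ∉ s → inner ℂ (b i) x = 0 := by
  rw [coordinateSubspace, Submodule.mem_orthogonal]
  constructor
  · exact fun h i hi => h _ (Submodule.subset_span ⟨i, hi, rfl⟩)
  · intro h u hu
    induction hu using Submodule.span_induction with
    | mem x hx => obtain ⟨i, hi, rfl⟩ := hx; exact h i hi
    | zero => simp
    | add x y _ _ hx hy => rw [inner_add_left, hx, hy, add_zero]
    | smul a x _ hx => rw [inner_smul_left, hx, mul_zero]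

end CoordinateSubspace

variable {H : Type*} [NormedAddCommGroup H] [InnerProductSpace ℂ H] [CompleteSpace H]

/-! ### Projections and scalar measures of a resolution of the identity. -/

section General

variable (E : ResolutionOfIdentity H) {s t : Set ℝ}

theorem proj_proj (hs : MeasurableSet s) (ht : MeasurableSet t) (x : H) :
    E.proj s (E.proj t x) = E.proj (s ∩ t) x := by
  rw [E.proj_inter s t hs ht]
  rfl

theorem inner_proj_left (hs : MeasurableSet s) (x y : H) :
    inner ℂ (E.proj s x) y = inner ℂ x (E.proj s y) := by
  rw [← ContinuousLinearMap.adjoint_inner_right, ← ContinuousLinearMap.star_eq_adjoint,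
    (E.isStarProjection s hs).isSelfAdjoint.star_eq]

theorem inner_proj_self (hs : MeasurableSet s) (x : H) :
    inner ℂ x (E.proj s x) = ((‖E.proj s x‖ ^ 2 : ℝ) : ℂ) := by
  have h : E.proj s x = E.proj s (E.proj s x) := by rw [E.proj_proj hs hs, Set.inter_self]
  conv_lhs => rw [h]
  rw [← E.inner_proj_left hs, inner_self_eq_norm_sq_to_K]
  push_cast
  rfl

theorem diagMeasure_apply (hs : MeasurableSet s) (x : H) :
    E.diagMeasure x s = ENNReal.ofReal (‖E.proj s x‖ ^ 2) := by
  rw [diagMeasure, Measure.ofMeasurable_apply s hs, E.inner_proj_self hs, Complex.ofReal_re]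

theorem diagMeasure_univ (x : H) : E.diagMeasure x Set.univ = ENNReal.ofReal (‖x‖ ^ 2) := by
  rw [E.diagMeasure_apply .univ, E.proj_univ]
  rfl

instance isFiniteMeasure_diagMeasure (x : H) : IsFiniteMeasure (E.diagMeasure x) :=
  ⟨by rw [E.diagMeasure_univ]; exact ENNReal.ofReal_lt_top⟩

/-- Reduces membership of `E.proj s x` in the domain of `D` to integrability over `s`. -/
theorem diagMeasure_proj (hs : MeasurableSet s) (x : H) :
    E.diagMeasure (E.proj s x) = (E.diagMeasure x).restrict s := by
  ext t ht
  rw [Measure.restrict_apply ht, E.diagMeasure_apply ht, E.diagMeasure_apply (ht.inter hs),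
    E.proj_proj ht hs]

/-- The measure of `x - E.proj s x` has no mass on `s` and the same mass as that of `x` on `sᶜ`. -/
theorem norm_sub_proj_sq {s : Set ℝ} (hs : MeasurableSet s) (x : H) :
    ENNReal.ofReal (‖x - E.proj s x‖ ^ 2) = E.diagMeasure x sᶜ := by
  have h0 : E.proj s (x - E.proj s x) = 0 := by
    rw [map_sub, E.proj_proj hs hs, Set.inter_self, sub_self]
  have h1 : E.proj sᶜ (x - E.proj s x) = E.proj sᶜ x := by
    rw [map_sub, E.proj_proj hs.compl hs, Set.compl_inter_self, E.proj_empty]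
    simp
  rw [← E.diagMeasure_univ, ← measure_add_measure_compl hs, E.diagMeasure_apply hs,
    E.diagMeasure_apply hs.compl, E.diagMeasure_apply hs.compl, h0, h1]
  simp

theorem norm_proj_le {s : Set ℝ} (hs : MeasurableSet s) (x : H) : ‖E.proj s x‖ ≤ ‖x‖ := by
  have h : E.diagMeasure x s ≤ E.diagMeasure x Set.univ := measure_mono (Set.subset_univ s)
  rw [E.diagMeasure_apply hs, E.diagMeasure_univ, ENNReal.ofReal_le_ofReal_iff (by positivity)] at h
  exact le_of_sq_le_sq h (norm_nonneg _)

theorem mem_range_proj_iff {s : Set ℝ} (hs : MeasurableSet s) {x : H} :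
    x ∈ (E.proj s).range ↔ E.proj s x = x := by
  constructor
  · rintro ⟨y, rfl⟩
    exact (E.proj_proj hs hs y).trans (by rw [Set.inter_self]; rfl)
  · exact fun h => ⟨x, h⟩

end General

/-! ### The resolution of the identity of a diagonal operator. -/

section HilbertBasis

variable {ι : Type*} (b : HilbertBasis ι ℂ H) (lam : ι → ℝ)

instance (s : Set ℝ) : (coordinateSubspace b lam s).HasOrthogonalProjection := by
  unfold coordinateSubspace
  infer_instance

open Classical in
theorem inner_starProjection_coordinateSubspace (s : Set ℝ) (i : ι) (y : H) :
    inner ℂ (b i) ((coordinateSubspace b lam s).starProjection y) =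
      if lam i ∈ s then inner ℂ (b i) y else 0 := by
  split_ifs with h
  · rw [← Submodule.inner_starProjection_left_eq_right, Submodule.starProjection_eq_self_iff.2]
    refine (mem_coordinateSubspace_iff b lam).2 fun j hj => ?_
    exact b.orthonormal.2 fun hji => hj (hji ▸ h)
  · exact (mem_coordinateSubspace_iff b lam).1 (Submodule.starProjection_apply_mem _ _) i h

theorem hasSum_inner_starProjection (s : Set ℝ) (x y : H) :
    HasSum (fun i : lam ⁻¹' s => inner ℂ x (b i) * inner ℂ (b i) y)
      (inner ℂ x ((coordinateSubspace b lam s).starProjection y)) := by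
  classical
  refine (hasSum_subtype_iff_indicator (f := fun i => inner ℂ x (b i) * inner ℂ (b i) y)).2 ?_
  have h := b.hasSum_inner_mul_inner x ((coordinateSubspace b lam s).starProjection y)
  refine h.congr_fun fun i => ?_
  rw [inner_starProjection_coordinateSubspace]
  simp [Set.indicator_apply]

theorem hasSum_re_inner_starProjection (s : Set ℝ) (x : H) :
    HasSum ((lam ⁻¹' s).indicator fun i => ‖inner ℂ (b i) x‖ ^ 2)
      (inner ℂ x ((coordinateSubspace b lam s).starProjection x)).re := by
  have h := Complex.hasSum_re (hasSum_inner_starProjection b lam s x x)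
  refine hasSum_subtype_iff_indicator.1 (h.congr_fun fun i => ?_)
  rw [← inner_conj_symm x, ← Complex.normSq_eq_conj_mul_self, Complex.ofReal_re,
    Complex.normSq_eq_norm_sq]
  rfl

open Classical in
/-- The resolution of the identity of the operator that is diagonal in the Hilbert basis `b`, with
diagonal entries `lam`. -/
noncomputable def ofHilbertBasis : ResolutionOfIdentity H where
  proj s := if MeasurableSet s then (coordinateSubspace b lam s).starProjection else 0
  not_measurable s hs := if_neg hs
  proj_empty := by
    ext y
    simp only [MeasurableSet.empty, if_true]
    exact b.ext_inner fun i => by rw [inner_starProjection_coordinateSubspace]; simp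
  proj_univ := by
    ext y
    simp only [MeasurableSet.univ, if_true]
    exact b.ext_inner fun i => by rw [inner_starProjection_coordinateSubspace]; simp
  isStarProjection s hs := by
    rw [if_pos hs]
    exact isStarProjection_starProjection
  proj_inter s t hs ht := by
    ext y
    rw [if_pos hs, if_pos ht, if_pos (hs.inter ht)]
    refine b.ext_inner fun i => ?_
    rw [mul_apply_eq_comp]
    simp only [inner_starProjection_coordinateSubspace, Set.mem_inter_iff]
    split_ifs <;> simp_all
  hasSum_iUnion f hf hd x y := by
    simp only [hf, MeasurableSet.iUnion hf, if_true]
    have hd' : Pairwise (Function.onFun Disjoint fun n => lam ⁻¹' f n) := fun m n h =>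
      (hd h).preimage lam
    have h := hasSum_inner_starProjection b lam (⋃ n, f n) x y
    rw [Set.preimage_iUnion] at h
    -- Disjointness turns the sum over the union into an iterated sum, one inner sum for each `f n`.
    have h' := (Set.unionEqSigmaOfDisjoint hd').symm.hasSum_iff.2 h
    exact h'.sigma fun n => hasSum_inner_starProjection b lam (f n) x y

theorem diagMeasure_ofHilbertBasis (x : H) :
    (ofHilbertBasis b lam).diagMeasure x =
      Measure.sum fun i => ENNReal.ofReal (‖inner ℂ (b i) x‖ ^ 2) • Measure.dirac (lam i) := by
  ext s hs
  have h := hasSum_re_inner_starProjection b lam s x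
  have hp : (ofHilbertBasis b lam).proj s = (coordinateSubspace b lam s).starProjection :=
    if_pos hs
  rw [diagMeasure, Measure.ofMeasurable_apply s hs, Measure.sum_apply _ hs, hp, ← h.tsum_eq,
    ENNReal.ofReal_tsum_of_nonneg (Set.indicator_nonneg fun _ _ => by positivity) h.summable]
  refine tsum_congr fun i => ?_
  rw [Measure.smul_apply, Measure.dirac_apply' _ hs]
  by_cases hi : lam i ∈ s
  · simp [Set.indicator, hi]
  · simp [Set.indicator, hi]

theorem integrable_sq_diagMeasure_ofHilbertBasis (x : H) :
    Integrable (fun t : ℝ => t ^ 2) ((ofHilbertBasis b lam).diagMeasure x) ↔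
      Summable fun i => lam i ^ 2 * ‖inner ℂ (b i) x‖ ^ 2 := by
  have h : ∫⁻ t : ℝ, ‖t ^ 2‖ₑ ∂((ofHilbertBasis b lam).diagMeasure x) =
      ∑' i, ENNReal.ofReal (lam i ^ 2 * ‖inner ℂ (b i) x‖ ^ 2) := by
    rw [diagMeasure_ofHilbertBasis, lintegral_sum_measure]
    refine tsum_congr fun i => ?_
    rw [lintegral_smul_measure, lintegral_dirac, smul_eq_mul, mul_comm,
      ENNReal.ofReal_mul (by positivity), Real.enorm_eq_ofReal (by positivity)]
  have hm : AEStronglyMeasurable (fun t : ℝ => t ^ 2) ((ofHilbertBasis b lam).diagMeasure x) := by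
    fun_prop
  rw [Integrable, and_iff_right hm, HasFiniteIntegral, h]
  constructor
  · intro h
    have := ENNReal.summable_toReal h.ne
    refine this.congr fun i => ?_
    rw [ENNReal.toReal_ofReal (by positivity)]
  · intro h
    rw [← ENNReal.ofReal_tsum_of_nonneg (fun i => by positivity) h]
    exact ENNReal.ofReal_lt_top

theorem hasSum_integral_diagMeasure_ofHilbertBasis {x : H}
    (hx : Integrable (fun t : ℝ => t) ((ofHilbertBasis b lam).diagMeasure x)) :
    HasSum (fun i => lam i * ‖inner ℂ (b i) x‖ ^ 2)
      (∫ t : ℝ, t ∂((ofHilbertBasis b lam).diagMeasure x)) := by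
  rw [diagMeasure_ofHilbertBasis] at hx ⊢
  refine (hasSum_integral_measure hx).congr_fun fun i => ?_
  rw [integral_smul_measure, integral_dirac, ENNReal.toReal_ofReal (by positivity), smul_eq_mul,
    mul_comm]

end HilbertBasis

end ResolutionOfIdentity

/-- A compact symmetric operator has a Hilbert basis of eigenvectors. -/
theorem ContinuousLinearMap.exists_hilbertBasis_eigenvectors {H : Type u} [NormedAddCommGroup H]
    [InnerProductSpace ℂ H] [CompleteSpace H] {T : H →L[ℂ] H} (hT : IsCompactOperator T)
    (hT' : T.IsSymmetric) :
    ∃ (ι : Type u) (b : HilbertBasis ι ℂ H) (μ : ι → ℝ), ∀ i, T (b i) = (μ i : ℂ) • b i := by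
  have hV := hT'.orthogonalFamily_eigenspaces
  have hc : ∀ z : ℂ, CompleteSpace (Module.End.eigenspace (T : Module.End ℂ H) z) := fun z => by
    have : IsClosed (Module.End.eigenspace (T : Module.End ℂ H) z : Set H) := by
      have : (Module.End.eigenspace (T : Module.End ℂ H) z : Set H) = {x | T x = z • x} := by
        ext x
        exact Module.End.mem_eigenspace_iff
      rw [this]
      exact isClosed_eq T.continuous (continuous_const_smul z)
    exact this.completeSpace_coe
  choose w c hcw using fun z : ℂ =>
    exists_hilbertBasis ℂ (Module.End.eigenspace (T : Module.End ℂ H) z)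
  let v : (Σ z, w z) → H := fun a => (c a.1 a.2 : Module.End.eigenspace (T : Module.End ℂ H) a.1)
  have hv : Orthonormal ℂ v := hV.orthonormal_sigma_orthonormal fun z => (c z).orthonormal
  have hmem : ∀ a, T (v a) = a.1 • v a := fun a =>
    Module.End.mem_eigenspace_iff.1 (c a.1 a.2).2
  -- A vector orthogonal to all the eigenbases has zero projection to every eigenspace.
  have hsp : (Submodule.span ℂ (Set.range v))ᗮ = ⊥ := by
    rw [eq_bot_iff, ← T.orthogonalComplement_iSup_eigenspaces_eq_bot hT hT']
    intro x hx
    rw [← Submodule.iInf_orthogonal, Submodule.mem_iInf]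
    intro z
    rw [Submodule.mem_orthogonal]
    intro u hu
    have h0 : (c z).repr ((Module.End.eigenspace (T : Module.End ℂ H) z).orthogonalProjectionOnto x)
        = 0 := by
      ext i
      rw [(c z).repr_apply_apply, Submodule.inner_orthogonalProjectionOnto_eq_of_mem_left]
      exact (Submodule.mem_orthogonal _ _).1 hx _ (Submodule.subset_span ⟨⟨z, i⟩, rfl⟩)
    have h1 := (c z).repr.map_eq_zero_iff.1 h0
    rw [← Submodule.inner_orthogonalProjectionOnto_eq_of_mem_left (⟨u, hu⟩ :
      Module.End.eigenspace (T : Module.End ℂ H) z), h1, inner_zero_right]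
  refine ⟨_, HilbertBasis.mkOfOrthogonalEqBot hv hsp, fun a => a.1.re, fun a => ?_⟩
  rw [HilbertBasis.coe_mkOfOrthogonalEqBot, hmem a]
  have h := hT'.conj_eigenvalue_eq_self (Module.End.hasEigenvalue_of_hasEigenvector
    ⟨Module.End.mem_eigenspace_iff.2 (hmem a), hv.ne_zero a⟩)
  rw [Complex.conj_eq_iff_re.1 h]

/-! ### Positive self-adjoint operators: closedness and the resolvent at `-1`. -/

namespace LinearPMap

open Filter Topology

variable {H : Type u} [NormedAddCommGroup H] [InnerProductSpace ℂ H] {D : H →ₗ.[ℂ] H}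

/-- Coercivity `‖x‖² ≤ Re ⟨x, (D + 1) x⟩` with Cauchy–Schwarz. It makes `D + 1` injective with
contractive inverse, and helps close its range. -/
theorem norm_le_norm_apply_add (hpos : ∀ x : D.domain, 0 ≤ (inner ℂ (x : H) (D x)).re)
    (x : D.domain) : ‖(x : H)‖ ≤ ‖D x + x‖ := by
  have h1 : ‖(x : H)‖ ^ 2 ≤ (inner ℂ (x : H) (D x + x)).re := by
    rw [inner_add_right, Complex.add_re, inner_self_eq_norm_sq_to_K]
    have : (((‖(x : H)‖ : ℂ)) ^ 2).re = ‖(x : H)‖ ^ 2 := by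
      rw [← Complex.ofReal_pow, Complex.ofReal_re]
    have h := hpos x
    simp only [Complex.coe_algebraMap] at *
    linarith
  have h2 : (inner ℂ (x : H) (D x + x)).re ≤ ‖(x : H)‖ * ‖D x + x‖ :=
    (Complex.re_le_norm _).trans (norm_inner_le_norm _ _)
  rcases (norm_nonneg (x : H)).eq_or_lt with h | h
  · rw [← h]; positivity
  · exact le_of_mul_le_mul_left (by nlinarith) h

variable [CompleteSpace H]

theorem inner_apply_left_of_isSelfAdjoint (hD : IsSelfAdjoint D) (x y : D.domain) :
    inner ℂ (D x) (y : H) = inner ℂ (x : H) (D y) := by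
  have h := adjoint_isFormalAdjoint hD.dense_domain
  rw [isSelfAdjoint_def.1 hD] at h
  exact h x y

theorem exists_apply_eq_of_isSelfAdjoint (hD : IsSelfAdjoint D) {y w : H}
    (h : ∀ x : D.domain, inner ℂ w (x : H) = inner ℂ y (D x)) :
    ∃ hy : y ∈ D.domain, D ⟨y, hy⟩ = w := by
  have h1 : ∃ hy : y ∈ D.adjoint.domain, D.adjoint ⟨y, hy⟩ = w :=
    ⟨mem_adjoint_domain_of_exists y ⟨w, h⟩, adjoint_apply_eq hD.dense_domain _ h⟩
  rwa [isSelfAdjoint_def.1 hD] at h1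

theorem exists_apply_eq_of_tendsto (hD : IsSelfAdjoint D) {x : ℕ → D.domain} {y w : H}
    (hx : Tendsto (fun n => (x n : H)) atTop (𝓝 y)) (hw : Tendsto (fun n => D (x n)) atTop (𝓝 w)) :
    ∃ hy : y ∈ D.domain, D ⟨y, hy⟩ = w := by
  refine exists_apply_eq_of_isSelfAdjoint hD fun z => ?_
  refine tendsto_nhds_unique (hw.inner tendsto_const_nhds) ?_
  simp only [inner_apply_left_of_isSelfAdjoint hD]
  exact hx.inner tendsto_const_nhds

/-- The images `D (x n)` need not converge in norm. Passing to the limit in `⟨D (x n), z⟩ = ⟨x n, D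
z⟩` bounds `⟨y, D z⟩` by `√(1 - ‖y‖²) ‖z‖`. This puts `y` in the domain of the adjoint, and density
of the domain bounds `‖D y‖`. -/
theorem isClosed_graphUnitBall (hD : IsSelfAdjoint D) : _root_.IsClosed (graphUnitBall D) := by
  refine IsSeqClosed.isClosed fun x y hx hxy => ?_
  choose hx hn using hx
  have hn1 : ∀ n, ‖D ⟨x n, hx n⟩‖ ≤ √(1 - ‖x n‖ ^ 2) := fun n =>
    Real.le_sqrt_of_sq_le (by linarith [hn n])
  have hlim : Tendsto (fun n => √(1 - ‖x n‖ ^ 2)) atTop (𝓝 √(1 - ‖y‖ ^ 2)) :=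
    ((hxy.norm.pow 2).const_sub 1).sqrt
  have hy1 : ‖y‖ ^ 2 ≤ 1 := le_of_tendsto' (hxy.norm.pow 2) fun n => by
    nlinarith [hn n, sq_nonneg ‖D ⟨x n, hx n⟩‖]
  have hbound : ∀ z : D.domain, ‖inner ℂ y (D z)‖ ≤ √(1 - ‖y‖ ^ 2) * ‖(z : H)‖ := by
    intro z
    refine le_of_tendsto_of_tendsto' (hxy.inner tendsto_const_nhds).norm (hlim.mul_const _)
      fun n => ?_
    have h := inner_apply_left_of_isSelfAdjoint hD ⟨x n, hx n⟩ z
    dsimp only at h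
    rw [← h]
    exact (norm_inner_le_norm _ _).trans (by gcongr; exact hn1 n)
  have hy : y ∈ D.domain := by
    have h : y ∈ D.adjoint.domain := by
      rw [mem_adjoint_domain_iff]
      exact AddMonoidHomClass.continuous_of_bound ((innerₛₗ ℂ y).comp D.toFun) _ hbound
    rwa [isSelfAdjoint_def.1 hD] at h
  refine ⟨hy, ?_⟩
  have hbound' : ∀ z : H, ‖inner ℂ (D ⟨y, hy⟩) z‖ ≤ √(1 - ‖y‖ ^ 2) * ‖z‖ := by
    intro z
    refine hD.dense_domain.induction (P := fun z =>
      ‖inner ℂ (D ⟨y, hy⟩) z‖ ≤ √(1 - ‖y‖ ^ 2) * ‖z‖) (fun z hz => ?_) ?_ z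
    · rw [inner_apply_left_of_isSelfAdjoint hD ⟨y, hy⟩ ⟨z, hz⟩]
      exact hbound ⟨z, hz⟩
    · exact isClosed_le (by fun_prop) (by fun_prop)
  have h := ContinuousLinearMap.opNorm_le_bound (innerSL ℂ (D ⟨y, hy⟩)) (Real.sqrt_nonneg _) hbound'
  rw [innerSL_apply_norm] at h
  have h2 := pow_le_pow_left₀ (norm_nonneg _) h 2
  rw [Real.sq_sqrt (by linarith)] at h2
  linarith

/-- The range of `D + 1` is closed, and a vector `z` orthogonal to it satisfies `D z = -z`, so
coercivity gives `z = 0`. -/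
theorem exists_apply_add_eq (hD : IsSelfAdjoint D)
    (hpos : ∀ x : D.domain, 0 ≤ (inner ℂ (x : H) (D x)).re) (y : H) :
    ∃ x : D.domain, D x + x = y := by
  let T : D.domain →ₗ[ℂ] H := D.toFun + D.domain.subtype
  have hT : ∀ x, T x = D x + x := fun _ => rfl
  have hcl : _root_.IsClosed (LinearMap.range T : Set H) := by
    refine IsSeqClosed.isClosed fun u y hu huy => ?_
    choose x hx using hu
    have hc : CauchySeq fun n => (x n : H) := by
      refine Metric.cauchySeq_iff.2 fun ε hε => ?_
      obtain ⟨N, hN⟩ := Metric.cauchySeq_iff.1 huy.cauchySeq ε hε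
      refine ⟨N, fun m hm n hn => lt_of_le_of_lt ?_ (hN m hm n hn)⟩
      have h := norm_le_norm_apply_add hpos (x m - x n)
      rw [← hT, T.map_sub, hx, hx] at h
      rw [dist_eq_norm, dist_eq_norm]
      exact h
    obtain ⟨z, hz⟩ := cauchySeq_tendsto_of_complete hc
    have hDz : Tendsto (fun n => D (x n)) atTop (𝓝 (y - z)) := by
      refine (huy.sub hz).congr fun n => ?_
      rw [← hx, hT, add_sub_cancel_right]
    obtain ⟨hzd, hz'⟩ := exists_apply_eq_of_tendsto hD hz hDz
    exact ⟨⟨z, hzd⟩, by rw [hT, hz', sub_add_cancel]⟩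
  have : CompleteSpace (LinearMap.range T) := hcl.completeSpace_coe
  have hbot : (LinearMap.range T)ᗮ = ⊥ := by
    rw [eq_bot_iff]
    intro z hz
    have h : ∀ x : D.domain, inner ℂ (-z) (x : H) = inner ℂ z (D x) := by
      intro x
      have := (Submodule.mem_orthogonal' _ _).1 hz _ ⟨x, rfl⟩
      rw [hT, inner_add_right] at this
      rw [inner_neg_left]
      linear_combination -this
    obtain ⟨hzd, hDz⟩ := exists_apply_eq_of_isSelfAdjoint hD h
    have h1 := norm_le_norm_apply_add hpos ⟨z, hzd⟩
    rw [hDz] at h1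
    simpa using h1
  rw [Submodule.orthogonal_eq_bot_iff] at hbot
  obtain ⟨x, hx⟩ := hbot ▸ (Submodule.mem_top : y ∈ _)
  exact ⟨x, hx⟩

/-- A positive self-adjoint operator whose graph norm has a compact unit ball is diagonal in some
Hilbert basis. -/
theorem exists_hilbertBasis_of_isCompact_graphUnitBall (hD : IsSelfAdjoint D)
    (hpos : ∀ x : D.domain, 0 ≤ (inner ℂ (x : H) (D x)).re) (hc : IsCompact (graphUnitBall D)) :
    ∃ (ι : Type u) (b : HilbertBasis ι ℂ H) (lam : ι → ℝ),
      ∀ i, ∃ h : b i ∈ D.domain, D ⟨b i, h⟩ = (lam i : ℂ) • b i := by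
  let T : D.domain →ₗ[ℂ] H := D.toFun + D.domain.subtype
  have hT : ∀ x, T x = D x + x := fun _ => rfl
  have hbij : Function.Bijective T := by
    refine ⟨(injective_iff_map_eq_zero T).2 fun x hx => ?_, exists_apply_add_eq hD hpos⟩
    have h := norm_le_norm_apply_add hpos x
    rw [← hT, hx, norm_zero, norm_le_zero_iff] at h
    exact Subtype.ext h
  let e := LinearEquiv.ofBijective T hbij
  let R : H →ₗ[ℂ] H := D.domain.subtype ∘ₗ e.symm.toLinearMap
  have hR : ∀ y, D (e.symm y) + (e.symm y : H) = y := e.apply_symm_apply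
  have hRn : ∀ y, ‖R y‖ ≤ ‖y‖ := fun y => by
    have h := norm_le_norm_apply_add hpos (e.symm y)
    rwa [hR] at h
  have hRc : IsCompactOperator R := by
    -- With `‖y‖ ≤ 1/3` one has `‖R y‖ ≤ 1/3` and `‖D (R y)‖ ≤ 2/3`, and `1/9 + 4/9 ≤ 1`.
    refine (isCompactOperator_iff_image_closedBall_subset_compact (𝕜₁ := ℂ) (𝕜₂ := ℂ) R
      (r := 1 / 3) (by norm_num)).2 ⟨_, hc, ?_⟩
    rintro _ ⟨y, hy, rfl⟩
    rw [mem_closedBall_zero_iff] at hy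
    refine ⟨(e.symm y).2, ?_⟩
    have h1 : ‖R y‖ ≤ 1 / 3 := (hRn y).trans hy
    have h2 : ‖D (e.symm y)‖ ≤ 2 / 3 := by
      have : D (e.symm y) = y - R y := eq_sub_of_add_eq (hR y)
      rw [this]
      linarith [norm_sub_le y (R y)]
    change ‖D (e.symm y)‖ ^ 2 + ‖R y‖ ^ 2 ≤ 1
    nlinarith [norm_nonneg (R y), norm_nonneg (D (e.symm y))]
  let S : H →L[ℂ] H := R.mkContinuous 1 fun y => by rw [one_mul]; exact hRn y
  have hS : S.IsSymmetric := by
    intro x y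
    change inner ℂ (e.symm x : H) y = inner ℂ x (e.symm y : H)
    conv_lhs => rw [← hR y]
    conv_rhs => rw [← hR x]
    rw [inner_add_left, inner_add_right, inner_apply_left_of_isSelfAdjoint hD]
  obtain ⟨ι, b, μ, hb⟩ := ContinuousLinearMap.exists_hilbertBasis_eigenvectors (T := S) hRc hS
  -- An eigenvalue `μ` of `(D + 1)⁻¹` is nonzero by injectivity and gives the eigenvalue `μ⁻¹ - 1`
  -- of `D`.
  refine ⟨ι, b, fun i => (μ i)⁻¹ - 1, fun i => ?_⟩
  have hb' : (e.symm (b i) : H) = (μ i : ℂ) • b i := hb i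
  have hμ : (μ i : ℂ) ≠ 0 := by
    intro h
    rw [h, zero_smul] at hb'
    have := hR (b i)
    rw [Subtype.ext (a2 := (0 : D.domain)) hb'] at this
    simp at this
    exact b.orthonormal.ne_zero i this.symm
  have hbi : b i = (μ i : ℂ)⁻¹ • (e.symm (b i) : H) := by rw [hb', inv_smul_smul₀ hμ]
  have hd : b i ∈ D.domain := by
    rw [hbi]
    exact D.domain.smul_mem _ (e.symm (b i)).2
  have hbi' : (⟨b i, hd⟩ : D.domain) = (μ i : ℂ)⁻¹ • e.symm (b i) := Subtype.ext hbi
  refine ⟨hd, ?_⟩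
  rw [hbi', map_smul, eq_sub_of_add_eq (hR (b i)), hb', smul_sub, inv_smul_smul₀ hμ]
  push_cast
  rw [sub_smul, one_smul]

end LinearPMap

theorem MeasureTheory.Integrable.of_sq {μ : Measure ℝ} [IsFiniteMeasure μ]
    (h : Integrable (fun t : ℝ => t ^ 2) μ) : Integrable (fun t : ℝ => t) μ := by
  refine (h.add (integrable_const 1)).mono' measurable_id.aestronglyMeasurable (.of_forall fun t => ?_)
  rw [Real.norm_eq_abs, Pi.add_apply, abs_le]
  constructor <;> nlinarith [sq_nonneg (t - 1), sq_nonneg (t + 1)]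

/-! ### The domain of a self-adjoint operator with an eigenbasis. -/

namespace LinearPMap

open Filter Topology

variable {H : Type u} [NormedAddCommGroup H] [InnerProductSpace ℂ H] [CompleteSpace H]
  {D : H →ₗ.[ℂ] H}

section Diagonal

variable {ι : Type*} {b : HilbertBasis ι ℂ H} {lam : ι → ℝ}

theorem inner_apply_of_diagonal (hD : IsSelfAdjoint D)
    (hb : ∀ i, ∃ h : b i ∈ D.domain, D ⟨b i, h⟩ = (lam i : ℂ) • b i) (x : D.domain) (i : ι) :
    inner ℂ (b i) (D x) = lam i * inner ℂ (b i) (x : H) := by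
  obtain ⟨h, hi⟩ := hb i
  rw [← inner_apply_left_of_isSelfAdjoint hD ⟨b i, h⟩ x, hi, inner_smul_left, Complex.conj_ofReal]

theorem mem_domain_iff_of_diagonal (hD : IsSelfAdjoint D)
    (hb : ∀ i, ∃ h : b i ∈ D.domain, D ⟨b i, h⟩ = (lam i : ℂ) • b i) (x : H) :
    x ∈ D.domain ↔ Summable fun i => lam i ^ 2 * ‖inner ℂ (b i) x‖ ^ 2 := by
  constructor
  · intro hx
    refine (b.orthonormal.inner_products_summable (D ⟨x, hx⟩)).congr fun i => ?_
    rw [inner_apply_of_diagonal hD hb, norm_mul, mul_pow, Complex.norm_real, Real.norm_eq_abs,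
      sq_abs]
  · intro hs
    have hmem : Memℓp (fun i => (lam i : ℂ) * inner ℂ (b i) x) 2 := by
      refine memℓp_gen (hs.congr fun i => ?_)
      rw [norm_mul, Complex.norm_real, ENNReal.toReal_ofNat, Real.rpow_ofNat, mul_pow,
        Real.norm_eq_abs, sq_abs]
    -- `w` is the candidate for `D x`; Parseval gives `⟨w, z⟩ = ⟨x, D z⟩`, so self-adjointness puts
    -- `x` in the domain.
    let w : H := b.repr.symm ⟨_, hmem⟩
    have hw : ∀ i, inner ℂ (b i) w = lam i * inner ℂ (b i) x := fun i => by
      rw [← b.repr_apply_apply, b.repr.apply_symm_apply]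
    refine (exists_apply_eq_of_isSelfAdjoint hD (w := w) fun z => ?_).1
    rw [← b.tsum_inner_mul_inner, ← b.tsum_inner_mul_inner]
    refine tsum_congr fun i => ?_
    rw [inner_apply_of_diagonal hD hb, ← inner_conj_symm w, hw, map_mul, Complex.conj_ofReal,
      inner_conj_symm]
    ring

end Diagonal

end LinearPMap

/-! ### Spectral decompositions and compactness of the graph ball. -/

namespace ResolutionOfIdentity

open LinearPMap

variable {H : Type u} [NormedAddCommGroup H] [InnerProductSpace ℂ H] [CompleteSpace H]
  {D : H →ₗ.[ℂ] H}

theorem isSpectralDecomposition_ofHilbertBasis {ι : Type*} {b : HilbertBasis ι ℂ H} {lam : ι → ℝ}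
    (hD : IsSelfAdjoint D)
    (hb : ∀ i, ∃ h : b i ∈ D.domain, D ⟨b i, h⟩ = (lam i : ℂ) • b i) :
    (ofHilbertBasis b lam).IsSpectralDecomposition D := by
  have hdom : ∀ x : H, x ∈ D.domain ↔
      Integrable (fun t : ℝ => t ^ 2) ((ofHilbertBasis b lam).diagMeasure x) := fun x => by
    rw [mem_domain_iff_of_diagonal hD hb, integrable_sq_diagMeasure_ofHilbertBasis]
  refine ⟨hdom, fun x => ?_⟩
  have h := hasSum_integral_diagMeasure_ofHilbertBasis b lam
    (Integrable.of_sq ((hdom x).1 x.2))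
  refine (b.hasSum_inner_mul_inner (x : H) (D x)).unique
    ((Complex.hasSum_ofReal.2 h).congr_fun fun i => ?_)
  rw [inner_apply_of_diagonal hD hb, ← inner_conj_symm (x : H), Complex.ofReal_mul,
    ← Complex.normSq_eq_norm_sq, Complex.normSq_eq_conj_mul_self]
  ring

variable {E : ResolutionOfIdentity H}

theorem IsSpectralDecomposition.proj_mem_domain (hE : E.IsSpectralDecomposition D) {s : Set ℝ}
    (hs : MeasurableSet s) {x : H} (hx : x ∈ D.domain) : E.proj s x ∈ D.domain := by
  rw [hE.1, E.diagMeasure_proj hs]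
  exact ((hE.1 x).1 hx).restrict

theorem IsSpectralDecomposition.proj_mem_domain_of_isBounded (hE : E.IsSpectralDecomposition D)
    {s : Set ℝ} (hs : MeasurableSet s) (hb : Bornology.IsBounded s) (x : H) :
    E.proj s x ∈ D.domain := by
  rw [hE.1, E.diagMeasure_proj hs]
  obtain ⟨C, hC⟩ := hb.exists_norm_le
  refine Integrable.of_bound (by fun_prop) (C ^ 2) ?_
  filter_upwards [ae_restrict_mem hs] with t ht
  rw [norm_pow]
  exact pow_le_pow_left₀ (norm_nonneg _) (hC t ht) 2

/-- Positivity at `E.proj (Set.Iio 0) x` makes the integral of a negative function nonnegative. -/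
theorem IsSpectralDecomposition.diagMeasure_Iio_zero (hE : E.IsSpectralDecomposition D)
    (hpos : ∀ x : D.domain, 0 ≤ (inner ℂ (x : H) (D x)).re) {x : H} (hx : x ∈ D.domain) :
    E.diagMeasure x (Set.Iio 0) = 0 := by
  have hi := Integrable.of_sq ((hE.1 x).1 hx)
  have h1 : 0 ≤ ∫ t in Set.Iio 0, t ∂(E.diagMeasure x) := by
    have h := hpos ⟨_, hE.proj_mem_domain (measurableSet_Iio (a := 0)) hx⟩
    rwa [hE.2, Complex.ofReal_re, E.diagMeasure_proj measurableSet_Iio] at h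
  have h0 : 0 ≤ᵐ[(E.diagMeasure x).restrict (Set.Iio 0)] fun t : ℝ => -t := by
    filter_upwards [ae_restrict_mem measurableSet_Iio] with t ht
    exact neg_nonneg.2 (le_of_lt ht)
  have h2 : ∫ t in Set.Iio 0, -t ∂(E.diagMeasure x) = 0 := by
    refine le_antisymm ?_ (integral_nonneg_of_ae h0)
    rw [integral_neg]
    linarith
  rw [integral_eq_zero_iff_of_nonneg_ae h0 hi.neg.restrict] at h2
  rw [← Measure.restrict_eq_zero, ← ae_eq_bot, ← Filter.empty_mem_iff_bot]
  filter_upwards [h2, ae_restrict_mem measurableSet_Iio] with t ht ht'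
  exact (ne_of_lt ht') (neg_eq_zero.1 ht)

/-- Markov's inequality for the mass on `[r, ∞)`, then Cauchy–Schwarz for the mean `⟨x, D x⟩`. -/
theorem IsSpectralDecomposition.norm_sub_proj_sq_le (hE : E.IsSpectralDecomposition D)
    (hpos : ∀ x : D.domain, 0 ≤ (inner ℂ (x : H) (D x)).re) (x : D.domain) {r : ℝ} (hr : 0 < r) :
    ‖(x : H) - E.proj (Set.Icc 0 r) x‖ ^ 2 ≤ ‖(x : H)‖ * ‖D x‖ / r := by
  have hi := Integrable.of_sq ((hE.1 x).1 x.2)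
  have h0 := hE.diagMeasure_Iio_zero hpos x.2
  have hae : 0 ≤ᵐ[E.diagMeasure (x : H)] fun t : ℝ => t := by
    filter_upwards [compl_mem_ae_iff.2 h0] with t ht
    exact not_lt.1 ht
  have hM := mul_meas_ge_le_integral_of_nonneg hae hi r
  have hint : ∫ t : ℝ, t ∂(E.diagMeasure (x : H)) ≤ ‖(x : H)‖ * ‖D x‖ := by
    have h := (Complex.re_le_norm _).trans (norm_inner_le_norm (𝕜 := ℂ) (x : H) (D x))
    rwa [hE.2, Complex.ofReal_re] at h
  have hle : E.diagMeasure (x : H) (Set.Icc 0 r)ᶜ ≤ E.diagMeasure (x : H) {t | r ≤ t} := by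
    have hsub : (Set.Icc 0 r)ᶜ ⊆ Set.Iio 0 ∪ {t | r ≤ t} := by
      intro t ht
      by_cases h : t < 0
      · exact Or.inl h
      · exact Or.inr (le_of_not_ge fun h' => ht ⟨not_lt.1 h, h'⟩)
    refine (measure_mono hsub).trans ((measure_union_le _ _).trans ?_)
    rw [h0, zero_add]
  rw [← E.norm_sub_proj_sq measurableSet_Icc] at hle
  rw [ENNReal.ofReal_le_iff_le_toReal (measure_ne_top _ _)] at hle
  rw [le_div_iff₀ hr]
  calc _ ≤ (E.diagMeasure (x : H)).real {t | r ≤ t} * r := by gcongr; exact hle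
    _ ≤ _ := by rw [mul_comm]; exact hM.trans hint

theorem IsSpectralDecomposition.isCompact_graphUnitBall (hE : E.IsSpectralDecomposition D)
    (hD : IsSelfAdjoint D) (hpos : ∀ x : D.domain, 0 ≤ (inner ℂ (x : H) (D x)).re)
    (hfin : E.FiniteDimOnBoundedIntervals) : IsCompact (graphUnitBall D) := by
  refine TotallyBounded.isCompact_of_isClosed ?_ (isClosed_graphUnitBall hD)
  refine Metric.totallyBounded_iff.2 fun ε hε => ?_
  -- Chosen so that `1 / r < (ε / 2) ^ 2`.
  let r : ℝ := 4 / ε ^ 2 + 1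
  have hr : 0 < r := by positivity
  have := hfin (Set.Icc 0 r) Set.ordConnected_Icc (Metric.isBounded_Icc 0 r)
  have := FiniteDimensional.proper ℂ (E.proj (Set.Icc 0 r)).range
  have hK : IsCompact (((↑) : (E.proj (Set.Icc 0 r)).range → H) '' Metric.closedBall 0 1) :=
    (isCompact_closedBall _ _).image continuous_subtype_val
  obtain ⟨t, ht, htK⟩ := Metric.totallyBounded_iff.1 hK.totallyBounded (ε / 2) (half_pos hε)
  refine ⟨t, ht, fun x hx => ?_⟩
  obtain ⟨hxd, hx1⟩ := hx
  have hn : ‖x‖ ≤ 1 := by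
    nlinarith [norm_nonneg x, sq_nonneg ‖D ⟨x, hxd⟩‖]
  have hDn : ‖D ⟨x, hxd⟩‖ ≤ 1 := by
    nlinarith [norm_nonneg (D ⟨x, hxd⟩), sq_nonneg ‖x‖]
  have hxK : E.proj (Set.Icc 0 r) x ∈
      ((↑) : (E.proj (Set.Icc 0 r)).range → H) '' Metric.closedBall 0 1 :=
    ⟨⟨_, x, rfl⟩, mem_closedBall_zero_iff.2 ((E.norm_proj_le measurableSet_Icc x).trans hn), rfl⟩
  obtain ⟨y, hy, hxy⟩ := Set.mem_iUnion₂.1 (htK hxK)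
  refine Set.mem_iUnion₂.2 ⟨y, hy, ?_⟩
  have hd : dist x (E.proj (Set.Icc 0 r) x) < ε / 2 := by
    rw [dist_eq_norm]
    refine lt_of_pow_lt_pow_left₀ 2 (half_pos hε).le ?_
    refine (hE.norm_sub_proj_sq_le hpos ⟨x, hxd⟩ hr).trans_lt ?_
    have h1 : ‖x‖ * ‖D ⟨x, hxd⟩‖ ≤ 1 := mul_le_one₀ hn (norm_nonneg _) hDn
    rw [div_lt_iff₀ hr]
    have h2 : (ε / 2) ^ 2 * r = 1 + (ε / 2) ^ 2 := by
      simp only [r]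
      field_simp
      ring
    rw [h2]
    have : 0 < (ε / 2) ^ 2 := by positivity
    linarith
  rw [Metric.mem_ball] at hxy ⊢
  linarith [dist_triangle x (E.proj (Set.Icc 0 r) x) y]

theorem IsSpectralDecomposition.finiteDimOnBoundedIntervals (hE : E.IsSpectralDecomposition D)
    (hD : IsSelfAdjoint D) (hc : IsCompact (graphUnitBall D)) :
    E.FiniteDimOnBoundedIntervals := by
  intro I hI hIb
  have hIm : MeasurableSet I := hI.measurableSet
  let K := (E.proj I).range
  have hKc : _root_.IsClosed (K : Set H) := by
    have : (K : Set H) = {x | E.proj I x = x} := by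
      ext x
      exact E.mem_range_proj_iff hIm
    rw [this]
    exact isClosed_eq (E.proj I).continuous continuous_id
  have : CompleteSpace K := hKc.completeSpace_coe
  have hK : K ≤ D.domain := by
    rintro _ ⟨y, rfl⟩
    exact hE.proj_mem_domain_of_isBounded hIm hIb y
  let A : K →ₗ[ℂ] H := D.toFun ∘ₗ Submodule.inclusion hK
  -- Closed graph theorem: `K` is complete and self-adjointness closes the graph.
  have hA : Continuous A := by
    refine A.continuous_of_seq_closed_graph fun u x y hu hAu => ?_
    obtain ⟨_, h⟩ := exists_apply_eq_of_tendsto hD (x := fun n => Submodule.inclusion hK (u n))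
      ((continuous_subtype_val.tendsto x).comp hu) hAu
    exact h.symm
  let B : K →L[ℂ] H := ⟨A, hA⟩
  -- For `‖x‖ ≤ r` this gives `‖B x‖ + ‖x‖ ≤ 1`, so the squares also sum to at most `1`.
  let r : ℝ := (1 + ‖B‖)⁻¹
  have hr : 0 < r := by positivity
  refine FiniteDimensional.of_isCompact_closedBall₀ ℂ (V := K) hr ?_
  refine (hKc.isClosedEmbedding_subtypeVal.isCompact_preimage hc).of_isClosed_subset
    Metric.isClosed_closedBall fun x hx => ⟨hK x.2, ?_⟩
  rw [mem_closedBall_zero_iff] at hx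
  have h1 : ‖B x‖ ≤ ‖B‖ * r := (B.le_opNorm x).trans (by gcongr; exact hx)
  have h2 : ‖B‖ * r + r = 1 := by
    simp only [r]
    field_simp
    ring
  change ‖B x‖ ^ 2 + ‖x‖ ^ 2 ≤ 1
  nlinarith [norm_nonneg (B x), norm_nonneg x, norm_nonneg B]

end ResolutionOfIdentity

theorem lemma1 {H : Type*} [NormedAddCommGroup H] [InnerProductSpace ℂ H] [CompleteSpace H]
    [TopologicalSpace.SeparableSpace H] (D : H →ₗ.[ℂ] H)
    (hD_selfAdjoint : IsSelfAdjoint D)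
    (hD_positive : ∀ x : D.domain, 0 ≤ (inner ℂ (x : H) (D x)).re)
    (hD_unbounded : ¬ ∃ C : ℝ, ∀ x : D.domain, ‖D x‖ ≤ C * ‖(x : H)‖) :
    (IsCompact (graphUnitBall D) ↔ HasFiniteDimSpectralProjections D) ∧
    ∀ E : ResolutionOfIdentity H, E.IsSpectralDecomposition D →
      (IsCompact (graphUnitBall D) ↔ E.FiniteDimOnBoundedIntervals) := by
  have key : ∀ E : ResolutionOfIdentity H, E.IsSpectralDecomposition D →
      (IsCompact (graphUnitBall D) ↔ E.FiniteDimOnBoundedIntervals) := fun E hE =>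
    ⟨hE.finiteDimOnBoundedIntervals hD_selfAdjoint,
      hE.isCompact_graphUnitBall hD_selfAdjoint hD_positive⟩
  refine ⟨⟨fun hc => ?_, fun ⟨E, hE, hfin⟩ => (key E hE).2 hfin⟩, key⟩
  obtain ⟨ι, b, lam, hb⟩ :=
    LinearPMap.exists_hilbertBasis_of_isCompact_graphUnitBall hD_selfAdjoint hD_positive hc
  have hE := ResolutionOfIdentity.isSpectralDecomposition_ofHilbertBasis hD_selfAdjoint hb
  exact ⟨_, hE, (key _ hE).1 hc⟩
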